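/- For a field $K$, let $W(K)$ be the $K$-vector space of all sequences $(u_n)_{n\ge 0}$ in $K$ satisfying $$4(n+4)u_{n+5}+8(n+2)u_{n+4}+(n+3)u_{n+3}+(4n+7)u_{n+2}+(5n+4)u_{n+1}+2n\,u_n=0\qquad\text{for all } n\ge 0.\tag{$*$}$$ Let $(c_n)_{n\ge 0}$ be the unique sequence of rational numbers satisfying $(*)$ with $c_0=0$, $c_1=1$, $c_2=2$, $c_3=-\tfrac18$, $c_4=-\tfrac12$. For a prime $p$ put $W_p=W(\mathbb F_p)$ and let $V_p\subseteq\mathbb F_p^4$ be the image of $W_p$ under the projection $(\bar C_n)_{n\ge 0}\mapsto(\bar C_1,\bar C_2,\bar C_3,\bar C_4)$. Theorem. For every prime $p$, the $\mathbb F_p$-vector space $W_p$ has infinite dimension. If $p\notin\{2,3,5,13\}$, then $V_p$ has dimension $2$ and is contained in the hyperplane of $\mathbb F_p^4$ defined by $6\bar C_4+\bar C_2+\bar C_1=0$. Moreover, for such $p$ the rational numbers $c_{p+1},c_{p+2},c_{p+3},c_{p+4}$ have denominators prime to $p$, and $V_p$ is spanned by $(1,2,-\tfrac18,-\tfrac12)$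 and the reduction modulo $p$ of $(c_{p+1},c_{p+2},c_{p+3},c_{p+4})$. -/

import Mathlib

namespace ModPRecurrence

/-- The sequence `u` satisfies, for every `n ≥ 0`, the recurrence
`4(n+4)u_{n+5} + 8(n+2)u_{n+4} + (n+3)u_{n+3} + (4n+7)u_{n+2} + (5n+4)u_{n+1} + 2n u_n = 0`. -/
def Satisfies {K : Type*} [Field K] (u : ℕ → K) : Prop :=
  ∀ n : ℕ, 4 * ((n : K) + 4) * u (n + 5) + 8 * ((n : K) + 2) * u (n + 4)
    + ((n : K) + 3) * u (n + 3) + (4 * (n : K) + 7) * u (n + 2)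
    + (5 * (n : K) + 4) * u (n + 1) + 2 * (n : K) * u n = 0

/-- The rational sequence with `c₀ = 0`, `c₁ = 1`, `c₂ = 2`, `c₃ = -1/8`, `c₄ = -1/2`
determined by the recurrence. -/
def c : ℕ → ℚ
  | 0 => 0
  | 1 => 1
  | 2 => 2
  | 3 => -1 / 8
  | 4 => -1 / 2
  | n + 5 => -(8 * ((n : ℚ) + 2) * c (n + 4) + ((n : ℚ) + 3) * c (n + 3)
      + (4 * (n : ℚ) + 7) * c (n + 2) + (5 * (n : ℚ) + 4) * c (n + 1)
      + 2 * (n : ℚ) * c n) / (4 * ((n : ℚ) + 4))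

theorem c_satisfies : Satisfies c := by
  intro n
  have h : (n : ℚ) + 4 ≠ 0 := by positivity
  rw [c]
  field_simp
  ring

/-- The vector space `W_K` of all sequences over `K` that satisfy the recurrence. -/
def W (K : Type*) [Field K] : Submodule K (ℕ → K) where
  carrier := {u | Satisfies u}
  zero_mem' := by
    intro n
    simp
  add_mem' := by
    intro u v hu hv n
    have h := congrArg₂ (· + ·) (hu n) (hv n)
    simp only [Pi.add_apply, add_zero] at h ⊢
    rw [← h]
    ring
  smul_mem' := by
    intro a u hu n
    have h := congrArg (a * ·) (hu n)
    simp only [Pi.smul_apply, smul_eq_mul, mul_zero] at h ⊢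
    rw [← h]
    ring

/-- The projection `(u₀, u₁, u₂, …) ↦ (u₁, u₂, u₃, u₄)`. -/
def proj (K : Type*) [Field K] : (ℕ → K) →ₗ[K] (Fin 4 → K) where
  toFun u := ![u 1, u 2, u 3, u 4]
  map_add' u v := by
    ext i
    fin_cases i <;> rfl
  map_smul' a u := by
    ext i
    fin_cases i <;> rfl

/-- The image of `W_K` under the projection. -/
def V (K : Type*) [Field K] : Submodule K (Fin 4 → K) :=
  (W K).map (proj K)

end ModPRecurrence

namespace ModPRecurrence

/-! For the generating function the recurrence says that (1+2x)S·xφ' − (4+16x+x³+x⁴)φ has no terms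
of degree ≥ 5, where S = 4+(x+x²)². The homogeneous equation is formally solved by x(1+2x)S^(-1/2).
Modulo an odd p the exponent −1/2 may be replaced by (p−1)/2, giving the polynomial solution `sol`;
multiplying it by any r(x^p) gives infinitely many more. Upper bound on V: an integrating factor,
again polynomial modulo p, forces the coefficients of `multiplier * remainder` in degrees ≡ −1 mod p
to vanish. The substitution x = (t−1)/2 keeps this condition and makes S even in t, so it splits
into two relations (`W.quadratic_relations`): one is the hyperplane, and the other is nontrivial by
`coeff_quadratic_pow_ne_zero`. Lower bound: if the second block of p coefficients of `sol` were t
times the first, then (1+tx)^p would divide `sol`, although x(1+2x)S is squarefree (`sol_ne_mul`).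
The rational sequence reduces to the normalised `sol` up to index p. There c_(p+1) stays p-integral,
and adding a multiple of x^p·`sol` matches its residue (`exists_lift_c`). -/

open PowerSeries in
/-- The differential operator attached to the recurrence. -/
noncomputable def diffOp {K : Type*} [Field K] (φ : PowerSeries K) : PowerSeries K :=
  (4 + 8 * X + X ^ 2 + 4 * X ^ 3 + 5 * X ^ 4 + 2 * X ^ 5) * (X * d⁄dX K φ)
    - (4 + 16 * X + X ^ 3 + X ^ 4) * φ

/-! ### The recurrence as a differential equation for the generating function. -/

section PowerSeries

open PowerSeries

variable {K : Type*} [Field K]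

theorem coeff_X_mul_derivative (φ : PowerSeries K) (n : ℕ) :
    coeff n (X * d⁄dX K φ) = n * coeff n φ := by
  cases n with
  | zero => simp
  | succ n => rw [coeff_succ_X_mul, coeff_derivative]; push_cast; ring

theorem diffOp_eq (φ : PowerSeries K) :
    diffOp φ = (4 : K) • (X * d⁄dX K φ) + (8 : K) • (X ^ 1 * (X * d⁄dX K φ))
      + X ^ 2 * (X * d⁄dX K φ) + (4 : K) • (X ^ 3 * (X * d⁄dX K φ))
      + (5 : K) • (X ^ 4 * (X * d⁄dX K φ)) + (2 : K) • (X ^ 5 * (X * d⁄dX K φ))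
      - ((4 : K) • φ + (16 : K) • (X ^ 1 * φ) + X ^ 3 * φ + X ^ 4 * φ) := by
  simp only [diffOp, smul_eq_C_mul, map_ofNat]
  ring

theorem coeff_diffOp (φ : PowerSeries K) (n : ℕ) :
    coeff (n + 5) (diffOp φ) = 4 * ((n : K) + 4) * coeff (n + 5) φ
      + 8 * ((n : K) + 2) * coeff (n + 4) φ + ((n : K) + 3) * coeff (n + 3) φ
      + (4 * (n : K) + 7) * coeff (n + 2) φ + (5 * (n : K) + 4) * coeff (n + 1) φ
      + 2 * (n : K) * coeff n φ := by
  rw [diffOp_eq]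
  simp only [map_add, map_sub, coeff_smul, coeff_X_pow_mul', coeff_X_mul_derivative]
  simp only [show 1 ≤ n + 5 by omega, show 2 ≤ n + 5 by omega, show 3 ≤ n + 5 by omega,
    show 4 ≤ n + 5 by omega, show 5 ≤ n + 5 by omega, if_true,
    show n + 5 - 1 = n + 4 by omega, show n + 5 - 2 = n + 3 by omega,
    show n + 5 - 3 = n + 2 by omega, show n + 5 - 4 = n + 1 by omega,
    show n + 5 - 5 = n by omega, smul_eq_mul]
  push_cast
  ring

theorem satisfies_iff_coeff_diffOp (u : ℕ → K) :
    Satisfies u ↔ ∀ n, coeff (n + 5) (diffOp (mk u)) = 0 := by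
  simp only [Satisfies, coeff_diffOp, coeff_mk]

/-- Degrees 0 to 4 are not constrained by the recurrence; these coefficients supply `remainder`. -/
theorem coeff_two_diffOp (φ : PowerSeries K) :
    coeff 2 (diffOp φ) = 4 * coeff 2 φ - 8 * coeff 1 φ := by
  rw [diffOp_eq]
  simp only [map_add, map_sub, coeff_smul, coeff_X_pow_mul', coeff_X_mul_derivative]
  simp
  ring

theorem coeff_three_diffOp (φ : PowerSeries K) :
    coeff 3 (diffOp φ) = 8 * coeff 3 φ + coeff 1 φ - coeff 0 φ := by
  rw [diffOp_eq]
  simp only [map_add, map_sub, coeff_smul, coeff_X_pow_mul', coeff_X_mul_derivative]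
  simp
  ring

theorem coeff_four_diffOp (φ : PowerSeries K) :
    coeff 4 (diffOp φ) = 12 * coeff 4 φ + 8 * coeff 3 φ + 2 * coeff 2 φ + 3 * coeff 1 φ
      - coeff 0 φ := by
  rw [diffOp_eq]
  simp only [map_add, map_sub, coeff_smul, coeff_X_pow_mul', coeff_X_mul_derivative]
  simp
  ring

theorem coeff_zero_diffOp (φ : PowerSeries K) : coeff 0 (diffOp φ) = -4 * coeff 0 φ := by
  rw [diffOp_eq]
  simp only [map_add, map_sub, coeff_smul, coeff_X_pow_mul', coeff_X_mul_derivative]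
  simp

theorem coeff_one_diffOp (φ : PowerSeries K) : coeff 1 (diffOp φ) = -16 * coeff 0 φ := by
  rw [diffOp_eq]
  simp only [map_add, map_sub, coeff_smul, coeff_X_pow_mul', coeff_X_mul_derivative]
  simp

end PowerSeries

/-! ### Polynomial solutions and infinite dimension. -/

section PolynomialSolution

open Polynomial

variable {K : Type*} [Field K]

/-- The quartic `4 + (x + x²)²`. -/
noncomputable def quartic (K : Type*) [Field K] : K[X] := 4 + (X + X ^ 2) ^ 2

/-- The differential equation for polynomials. -/
def IsPolySolution (q : K[X]) : Prop :=
  (4 + 8 * X + X ^ 2 + 4 * X ^ 3 + 5 * X ^ 4 + 2 * X ^ 5) * (X * derivative q)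
    = (4 + 16 * X + X ^ 3 + X ^ 4) * q

theorem IsPolySolution.diffOp_eq_zero {q : K[X]} (hq : IsPolySolution q) :
    diffOp (q : PowerSeries K) = 0 := by
  have h := congrArg (fun r : K[X] => (r : PowerSeries K)) hq
  have e (n : ℕ) [n.AtLeastTwo] : ((OfNat.ofNat n : K[X]) : PowerSeries K) = OfNat.ofNat n :=
    map_ofNat (Polynomial.coeToPowerSeries.ringHom (R := K)) n
  simp only [coe_mul, coe_add, coe_pow, coe_X, e] at h
  rw [diffOp, PowerSeries.derivative_coe, h, sub_self]

theorem IsPolySolution.coeff_mem_W {q : K[X]} (hq : IsPolySolution q) : q.coeff ∈ W K := by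
  change Satisfies _
  rw [satisfies_iff_coeff_diffOp]
  intro n
  have : PowerSeries.mk q.coeff = (q : PowerSeries K) := by ext; simp
  rw [this, hq.diffOp_eq_zero, map_zero]

/-- Since r(x^p) has derivative zero in characteristic p, it acts as a constant for the equation. -/
theorem IsPolySolution.expand_mul (p : ℕ) [CharP K p] {q : K[X]} (hq : IsPolySolution q)
    (r : K[X]) : IsPolySolution (expand K p r * q) := by
  unfold IsPolySolution at *
  rw [derivative_mul, derivative_expand]
  have : (p : K[X]) = 0 := CharP.cast_eq_zero _ p
  rw [this]
  linear_combination (expand K p r) * hq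

theorem not_finite_W_of_isPolySolution (p : ℕ) [Fact p.Prime] [CharP K p] {q : K[X]}
    (hq : IsPolySolution q) (h0 : q ≠ 0) : ¬ Module.Finite K (W K) := by
  intro hfin
  let Φ : K[X] →ₗ[K] W K :=
    { toFun := fun r => ⟨(expand K p r * q).coeff, (hq.expand_mul p r).coeff_mem_W⟩
      map_add' := fun r s => by ext n; simp [add_mul]
      map_smul' := fun a r => by
        ext n
        simp [smul_eq_C_mul, mul_assoc] }
  have hinj : Function.Injective Φ := by
    intro r s h
    have h1 : (expand K p r * q).coeff = (expand K p s * q).coeff := congrArg Subtype.val h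
    have h2 : expand K p r * q = expand K p s * q := Polynomial.coeff_injective h1
    exact expand_injective (Fact.out : p.Prime).pos (mul_right_cancel₀ h0 h2)
  exact Polynomial.not_finite (Module.Finite.of_injective Φ hinj)

/-- The polynomial solution `x (1 + 2x) (4 + (x + x²)²)ᵐ`. -/
noncomputable def sol (K : Type*) [Field K] (m : ℕ) : K[X] :=
  X * (1 + 2 * X) * quartic K ^ m

theorem derivative_quartic : derivative (quartic K) = 2 * (X + X ^ 2) * (1 + 2 * X) := by
  simp only [quartic, derivative_add, derivative_pow, derivative_ofNat, derivative_X]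
  simp only [Nat.cast_ofNat, map_ofNat]
  ring

/-- The logarithmic derivative sees the exponent of S only as an element of K, and there m = −1/2.
-/
theorem isPolySolution_sol {m : ℕ} (hm : (2 * m + 1 : K) = 0) : IsPolySolution (sol K m) := by
  unfold IsPolySolution sol
  have hm' : (2 * (m : K[X]) + 1) = 0 := by
    have := congrArg C hm
    simpa only [map_add, map_mul, map_ofNat, map_natCast, map_one, map_zero] using this
  have hd : quartic K * derivative (quartic K ^ m)
      = (m : K[X]) * quartic K ^ m * (2 * (X + X ^ 2) * (1 + 2 * X)) := by
    rw [derivative_pow, derivative_quartic]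
    cases m with
    | zero => simp
    | succ k => simp [pow_succ]; ring
  have hS : quartic K = 4 + (X + X ^ 2) ^ 2 := rfl
  simp only [derivative_mul, derivative_X, derivative_add, derivative_one, derivative_ofNat]
  generalize quartic K ^ m = G at *
  generalize derivative G = G' at *
  rw [hS] at hd
  linear_combination (X ^ 2 * (1 + 2 * X) ^ 2) * hd
    + (G * X ^ 2 * (1 + 2 * X) ^ 3 * (X + X ^ 2)) * hm'

/-- When 2 = 0 the equation reduces to (1+x)q' = q, solved by 1+x and so by x²(1+x). -/
theorem isPolySolution_of_two (h : (2 : K) = 0) : IsPolySolution (X ^ 2 + X ^ 3 : K[X]) := by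
  unfold IsPolySolution
  have h' : (2 : K[X]) = 0 := by
    have := congrArg C h
    rwa [map_ofNat, map_zero] at this
  simp only [derivative_add, derivative_X_pow, Nat.cast_ofNat, map_ofNat]
  linear_combination (2 * X ^ 2 + 4 * X ^ 3 + 5 * X ^ 4 + 5 * X ^ 5 + 10 * X ^ 6 + 9 * X ^ 7
    + 3 * X ^ 8) * h'

end PolynomialSolution

/-! ### The integrating factor and the two linear relations on V. -/

section Multiplier

open Polynomial

variable {K : Type*} [Field K]

/-- The factor `(1 + 2x)²ᵏ⁺¹ (4 + (x + x²)²)ᵏ⁺¹`, which makes `diffOp` exact when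
`2k + 3` is the characteristic. -/
noncomputable def multiplier (K : Type*) [Field K] (k : ℕ) : K[X] :=
  (1 + 2 * X) ^ (2 * k + 1) * quartic K ^ (k + 1)

/-- With p = 2k+3 the product is (1+2x)^(p−1)·S^((p+1)/2), which up to p-th powers is
S^(1/2)/(1+2x): x divided by the formal homogeneous solution. -/
theorem X_mul_derivative_multiplier {k : ℕ} (hk : (2 * k + 3 : K) = 0) :
    X * derivative (multiplier K k * ((1 + 2 * X) * quartic K))
        - multiplier K k * ((1 + 2 * X) * quartic K)
      = -(4 + 16 * X + X ^ 3 + X ^ 4) * multiplier K k := by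
  have hk' : (2 * (k : K[X]) + 3) = 0 := by
    have := congrArg C hk
    simpa only [map_add, map_mul, map_ofNat, map_natCast, map_zero] using this
  have e : multiplier K k * ((1 + 2 * X) * quartic K)
      = (1 + 2 * X) ^ (2 * k + 2) * quartic K ^ (k + 2) := by
    rw [multiplier]; ring
  rw [e, multiplier, derivative_mul, derivative_pow_succ, derivative_pow_succ,
    derivative_quartic]
  simp only [derivative_mul, derivative_X, derivative_one, derivative_ofNat,
    map_add, map_one, map_natCast, Nat.cast_add, Nat.cast_mul, Nat.cast_ofNat, map_mul, map_ofNat,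
    Nat.cast_one, pow_succ _ (k + 1), pow_succ _ (2 * k + 1)]
  generalize (1 + 2 * X : K[X]) ^ (2 * k + 1) = A
  have hS : quartic K = 4 + (X + X ^ 2) ^ 2 := rfl
  generalize quartic K ^ (k + 1) = B
  rw [hS]
  linear_combination (A * B * X * (2 * (4 + (X + X ^ 2) ^ 2)
    + (1 + 2 * X) ^ 2 * (X + X ^ 2))) * hk'

theorem coe_ofNat_toPowerSeries (n : ℕ) [n.AtLeastTwo] :
    ((ofNat(n) : K[X]) : PowerSeries K) = ofNat(n) :=
  map_ofNat (Polynomial.coeToPowerSeries.ringHom (R := K)) n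

theorem multiplier_mul_diffOp {k : ℕ} (hk : (2 * k + 3 : K) = 0) (φ : PowerSeries K) :
    (multiplier K k).toPowerSeries * diffOp φ
      = PowerSeries.X * PowerSeries.derivative K
          (φ * (multiplier K k * ((1 + 2 * X) * quartic K)).toPowerSeries)
        - φ * (multiplier K k * ((1 + 2 * X) * quartic K)).toPowerSeries := by
  have h := congrArg (fun r : K[X] => (r : PowerSeries K)) (X_mul_derivative_multiplier hk)
  simp only [Polynomial.coe_sub, Polynomial.coe_neg, coe_mul, coe_add, coe_pow, coe_X,
    coe_ofNat_toPowerSeries, coe_one] at h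
  rw [Derivation.leibniz, PowerSeries.derivative_coe, diffOp]
  simp only [coe_mul, coe_add, coe_pow, coe_X, coe_ofNat_toPowerSeries, coe_one, smul_eq_mul, quartic] at h ⊢
  linear_combination (-φ) * h

/-- The operator F ↦ xF' − F multiplies the coefficient of degree n by n − 1. -/
theorem coeff_multiplier_mul_diffOp (p : ℕ) [CharP K p] {k : ℕ} (hk : (2 * k + 3 : K) = 0)
    (φ : PowerSeries K) (j : ℕ) :
    PowerSeries.coeff (j * p + 1) ((multiplier K k).toPowerSeries * diffOp φ) = 0 := by
  rw [multiplier_mul_diffOp hk, map_sub, coeff_X_mul_derivative]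
  simp

/-- The term u₀ enters the recurrence only at n = 0, with coefficient 2n = 0. -/
theorem W.update_zero {u : ℕ → K} (hu : u ∈ W K) :
    (fun n => if n = 0 then 0 else u n) ∈ W K := by
  intro n
  have := hu n
  cases n <;> simpa using this

/-- The quadratic polynomial with `diffOp u = x² · remainder` when `u 0 = 0`. -/
noncomputable def remainder (u : ℕ → K) : K[X] :=
  C (4 * u 2 - 8 * u 1) + C (8 * u 3 + u 1) * X
    + C (12 * u 4 + 8 * u 3 + 2 * u 2 + 3 * u 1) * X ^ 2

theorem W.diffOp_eq {u : ℕ → K} (hu : u ∈ W K) :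
    diffOp (PowerSeries.mk fun n => if n = 0 then 0 else u n)
      = ((X ^ 2 * remainder u : K[X]) : PowerSeries K) := by
  have h := (satisfies_iff_coeff_diffOp fun n => if n = 0 then 0 else u n).1 (W.update_zero hu)
  ext n
  rw [coeff_coe, mul_comm, coeff_mul_X_pow']
  match n with
  | 0 => rw [coeff_zero_diffOp]; simp
  | 1 => rw [coeff_one_diffOp]; simp
  | 2 => rw [coeff_two_diffOp]; simp [remainder]
  | 3 =>
    rw [coeff_three_diffOp]
    simp only [remainder, coeff_add, coeff_C_mul, coeff_C, coeff_X, coeff_X_pow]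
    simp
  | 4 =>
    rw [coeff_four_diffOp]
    simp only [remainder, coeff_add, coeff_C_mul, coeff_C, coeff_X, coeff_X_pow]
    simp
  | n + 5 =>
    rw [h n]
    simp only [remainder, coeff_add, coeff_C_mul, coeff_C, coeff_X, coeff_X_pow]
    simp

theorem W.coeff_multiplier_mul_remainder (p : ℕ) [CharP K p] (hp : 1 ≤ p) {k : ℕ}
    (hk : (2 * k + 3 : K) = 0) {u : ℕ → K} (hu : u ∈ W K) (j : ℕ) :
    (multiplier K k * remainder u).coeff ((j + 1) * p - 1) = 0 := by
  have h := coeff_multiplier_mul_diffOp p hk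
    (PowerSeries.mk fun n => if n = 0 then 0 else u n) (j + 1)
  rw [W.diffOp_eq hu, ← coe_mul, coeff_coe] at h
  have e : (j + 1) * p + 1 = (j + 1) * p - 1 + 2 := by
    have : 1 ≤ (j + 1) * p := Nat.mul_pos (Nat.succ_pos j) hp
    omega
  rwa [e, show multiplier K k * (X ^ 2 * remainder u)
      = multiplier K k * remainder u * X ^ 2 by ring,
    coeff_mul_X_pow] at h

/-- In characteristic `p`, a polynomial is a derivative as soon as its coefficients in degrees
`≡ -1` vanish. -/
theorem exists_derivative_eq (p : ℕ) [CharP K p] (T : K[X])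
    (hT : ∀ j, T.coeff ((j + 1) * p - 1) = 0) : ∃ N : K[X], derivative N = T := by
  -- Termwise antiderivative; where i + 1 = 0 in K, division by zero yields 0, which is harmless
  -- because that coefficient of T vanishes.
  refine ⟨∑ i ∈ T.support, monomial (i + 1) (T.coeff i / (i + 1 : K)), ?_⟩
  conv_rhs => rw [T.as_sum_support]
  rw [derivative_sum]
  refine Finset.sum_congr rfl fun i _ => ?_
  rw [derivative_monomial]
  congr 1
  by_cases hi : ((i : K) + 1) = 0
  · have hi' : ((i + 1 : ℕ) : K) = 0 := by exact_mod_cast hi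
    obtain ⟨j, hj⟩ := (CharP.cast_eq_zero_iff K p _).1 hi'
    cases j with
    | zero => omega
    | succ j =>
      have := hT j
      rw [mul_comm, ← hj] at this
      simp at this
      simp [this]
  · push_cast
    field_simp

/-- A substitution mixes coefficients, but by the chain rule it preserves being a derivative. -/
theorem coeff_comp_linear_eq_zero (p : ℕ) [CharP K p] (hp : 1 ≤ p) (T : K[X])
    (hT : ∀ j, T.coeff ((j + 1) * p - 1) = 0) {a b : K} (ha : a ≠ 0) (j : ℕ) :
    (T.comp (C a * X + C b)).coeff ((j + 1) * p - 1) = 0 := by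
  obtain ⟨N, rfl⟩ := exists_derivative_eq p T hT
  have h := congrArg (fun r => coeff r ((j + 1) * p - 1))
    (derivative_comp N (C a * X + C b))
  have e : (j + 1) * p - 1 + 1 = (j + 1) * p :=
    Nat.sub_add_cancel (Nat.mul_pos (Nat.succ_pos j) hp)
  have e2 : (((j + 1) * p - 1 : ℕ) : K) + 1 = 0 := by
    have := congrArg (Nat.cast (R := K)) e
    push_cast at this
    simpa using this
  simp only [derivative_add, derivative_mul, derivative_C, derivative_X, zero_mul, zero_add,
    mul_one, add_zero, coeff_C_mul] at h
  rw [coeff_derivative, e2, mul_zero] at h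
  simpa [ha] using h.symm

/-- The quadratic `t² - 2t + 65`. -/
noncomputable def quadratic (K : Type*) [Field K] : K[X] := X ^ 2 - 2 * X + 65

/-- The substitution x = (t−1)/2 centres the symmetry x ↦ −1−x: 1+2x becomes t and 16S becomes t⁴ −
2t² + 65. The scalars α, β, γ are the coefficients of the remainder in t. -/
theorem multiplier_mul_remainder_comp (h2 : (2 : K) ≠ 0) (k : ℕ) (u : ℕ → K) {α β γ : K}
    (hγ : 4 * γ = 12 * u 4 + 8 * u 3 + 2 * u 2 + 3 * u 1)
    (hβ : 2 * β = 8 * u 3 + u 1 - 4 * γ)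
    (hα : α = 4 * u 2 - 8 * u 1 - β - γ) :
    (multiplier K k * remainder u).comp (C (1 / 2) * X + C (-1 / 2))
      = C ((1 / 16) ^ (k + 1)) * ((C α + C β * X + C γ * X ^ 2)
          * expand K 2 (quadratic K ^ (k + 1)) * X ^ (2 * k + 1)) := by
  have e1 : (2 : K[X]) * C (1 / 2) = 1 := by
    rw [← map_ofNat C 2, ← C_mul, mul_one_div_cancel h2, C_1]
  have e2 : C (-1 / 2 : K) = - C (1 / 2) := by rw [neg_div, C_neg]
  have e3 : C (1 / 16 : K) = C (1 / 2) ^ 4 := by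
    rw [← C_pow]; congr 1; rw [div_pow]; norm_num
  have hs : (1 + 2 * X : K[X]).comp (C (1 / 2) * X + C (-1 / 2)) = X := by
    simp only [add_comp, mul_comp, one_comp, ofNat_comp, X_comp, e2]
    linear_combination (X - 1) * e1
  have hq : (quartic K).comp (C (1 / 2) * X + C (-1 / 2))
      = C (1 / 16) * expand K 2 (quadratic K) := by
    simp only [quartic, quadratic, map_add, map_sub, map_mul, map_pow, map_ofNat, expand_X,
      add_comp, pow_comp, ofNat_comp, X_comp, e2, e3]
    generalize C (1 / 2 : K) = i at *
    push_cast
    linear_combination (-4 * (2 * i + 1) * (4 * i ^ 2 + 1)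
      - (i * X - i) * (i * X - i + (i * X - i) ^ 2 + i ^ 2 * (X ^ 2 - 1))) * e1
  have hr : (remainder u).comp (C (1 / 2) * X + C (-1 / 2))
      = C α + C β * X + C γ * X ^ 2 := by
    have ha : C (4 * u 2 - 8 * u 1) = C α + C β + C γ := by
      rw [← C_add, ← C_add, hα]; congr 1; ring
    have hb : C (8 * u 3 + u 1) = 2 * C β + 4 * C γ := by
      rw [← map_ofNat C 2, ← map_ofNat C 4, ← C_mul, ← C_mul, ← C_add, hβ]; congr 1; ring
    have hc : C (12 * u 4 + 8 * u 3 + 2 * u 2 + 3 * u 1) = 4 * C γ := by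
      rw [← map_ofNat C 4, ← C_mul, hγ]
    simp only [remainder, ha, hb, hc, add_comp, mul_comp, pow_comp, C_comp, X_comp, ofNat_comp,
      e2]
    linear_combination ((X - 1) * (C β + 2 * C γ)
      + C γ * (X - 1) ^ 2 * (2 * C (1 / 2) + 1)) * e1
  rw [mul_comp, multiplier, mul_comp, pow_comp, pow_comp, hs, hq, hr, map_pow, mul_pow, map_pow]
  ring

theorem W.quadratic_relations (p : ℕ) [CharP K p] {k : ℕ} (hp : p = 2 * k + 3)
    {u : ℕ → K} (hu : u ∈ W K) {α β γ : K}
    (hγ : 4 * γ = 12 * u 4 + 8 * u 3 + 2 * u 2 + 3 * u 1)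
    (hβ : 2 * β = 8 * u 3 + u 1 - 4 * γ)
    (hα : α = 4 * u 2 - 8 * u 1 - β - γ) :
    β * (quadratic K ^ (k + 1)).coeff 0 = 0 ∧
    α * (quadratic K ^ (k + 1)).coeff (k + 2) + γ * (quadratic K ^ (k + 1)).coeff (k + 1) = 0 := by
  have hk : (2 * k + 3 : K) = 0 := by
    have := CharP.cast_eq_zero K p
    rw [hp] at this
    exact_mod_cast this
  have h2 : (2 : K) ≠ 0 := by
    intro h
    have h1 : (1 : K) = 0 := by linear_combination hk - ((k : K) + 1) * h
    exact one_ne_zero h1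
  have hT := coeff_comp_linear_eq_zero p (by omega) _
    (W.coeff_multiplier_mul_remainder p (by omega) hk hu) (a := 1 / 2) (b := -1 / 2)
    (one_div_ne_zero h2)
  rw [multiplier_mul_remainder_comp h2 k u hγ hβ hα] at hT
  have h16 : ((1 / 16 : K) ^ (k + 1)) ≠ 0 := by
    have : (16 : K) ≠ 0 := by
      rw [show (16 : K) = 2 ^ 4 by norm_num]; exact pow_ne_zero _ h2
    exact pow_ne_zero _ (one_div_ne_zero this)
  generalize quadratic K ^ (k + 1) = g at *
  constructor
  -- Degree p − 1: after removing t^(2k+1), the coefficient of t remains, and by parity only β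
  -- contributes.
  · have h := hT 0
    rw [show (0 + 1) * p - 1 = 1 + (2 * k + 1) by omega, coeff_C_mul, coeff_mul_X_pow] at h
    have h := (mul_eq_zero.1 h).resolve_left h16
    have e : (C α + C β * X + C γ * X ^ 2) * expand K 2 g
        = C α * expand K 2 g + C β * (expand K 2 g * X ^ 1)
          + C γ * (expand K 2 g * X ^ 2) := by ring
    rw [e] at h
    simpa [coeff_expand, coeff_mul_X_pow'] using h
  -- Degree 2p − 1: the coefficient of t^(2k+4) remains, and by parity only α and γ contribute.
  · have h := hT 1
    rw [show (1 + 1) * p - 1 = (2 * k + 4) + (2 * k + 1) by omega, coeff_C_mul,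
      coeff_mul_X_pow] at h
    have h := (mul_eq_zero.1 h).resolve_left h16
    have e : (C α + C β * X + C γ * X ^ 2) * expand K 2 g
        = C α * expand K 2 g + C β * (expand K 2 g * X ^ 1)
          + C γ * (expand K 2 g * X ^ 2) := by ring
    rw [e] at h
    simpa [coeff_expand, coeff_mul_X_pow', show 2 ∣ 2 * k + 4 by omega,
      show ¬ 2 ∣ 2 * k + 3 by omega, show 2 ∣ 2 * k + 2 by omega,
      show (2 * k + 4) / 2 = k + 2 by omega, show (2 * k + 2) / 2 = k + 1 by omega] using h

theorem coeff_quadratic_pow_succ (m j : ℕ) :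
    65 * ((j : K) + 2) * (quadratic K ^ m).coeff (j + 2)
      = 2 * ((j : K) + 1 - m) * (quadratic K ^ m).coeff (j + 1)
        + (2 * m - j) * (quadratic K ^ m).coeff j := by
  have hd : quadratic K * derivative (quadratic K ^ m)
      = (m : K[X]) * quadratic K ^ m * (2 * X - 2) := by
    have h1 : derivative (quadratic K) = 2 * X - 2 := by
      simp only [quadratic, derivative_add, derivative_sub, derivative_mul, derivative_X_pow,
        derivative_ofNat, derivative_X, Nat.cast_ofNat, map_ofNat]
      ring
    rw [derivative_pow, h1]
    cases m with
    | zero => simp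
    | succ k => simp [pow_succ]; ring
  generalize quadratic K ^ m = g at *
  have e : C 65 * derivative g + derivative g * X ^ 2 - C 2 * (derivative g * X ^ 1)
      = C (2 * (m : K)) * (g * X ^ 1) - C (2 * (m : K)) * g := by
    simp only [map_ofNat, C_mul, map_natCast]
    rw [quadratic] at hd
    linear_combination hd
  have h := congrArg (fun r => coeff r (j + 1)) e
  simp only [coeff_add, coeff_sub, coeff_C_mul, coeff_mul_X_pow', coeff_derivative] at h
  cases j with
  | zero => simp at h ⊢; linear_combination h
  | succ j => simp at h ⊢; linear_combination h

/-- Two consecutive zeros would propagate down the three-term recurrence to the constant term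
65^(k+1): the factor 2(k+1) − j lies strictly between 0 and p for j ≤ k. -/
theorem coeff_quadratic_pow_ne_zero (p : ℕ) [Fact p.Prime] [CharP K p] {k : ℕ}
    (hp : p = 2 * k + 3) (h65 : (65 : K) ≠ 0)
    (h1 : (quadratic K ^ (k + 1)).coeff (k + 1) = 0) :
    (quadratic K ^ (k + 1)).coeff (k + 2) ≠ 0 := by
  intro h2
  have key : ∀ i, i ≤ k + 1 → (quadratic K ^ (k + 1)).coeff (k + 1 - i) = 0 ∧
      (quadratic K ^ (k + 1)).coeff (k + 2 - i) = 0 := by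
    intro i
    induction i with
    | zero => exact fun _ => ⟨h1, h2⟩
    | succ i ih =>
      intro hi
      obtain ⟨a, b⟩ := ih (by omega)
      obtain ⟨j, hj⟩ : ∃ j, k = i + j := ⟨k - i, by omega⟩
      rw [show k + 1 - i = j + 1 by omega] at a
      rw [show k + 2 - i = j + 2 by omega] at b
      rw [show k + 1 - (i + 1) = j by omega, show k + 2 - (i + 1) = j + 1 by omega]
      refine ⟨?_, a⟩
      have h := coeff_quadratic_pow_succ (K := K) (k + 1) j
      rw [a, b, mul_zero, mul_zero, zero_add] at h
      refine (mul_eq_zero.1 h.symm).resolve_left fun h0 => ?_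
      have h0' : ((2 * (k + 1) - j : ℕ) : K) = 0 := by
        rw [Nat.cast_sub (by omega)]; exact_mod_cast h0
      have := Nat.le_of_dvd (by omega) ((CharP.cast_eq_zero_iff K p _).1 h0')
      omega
  have h := (key (k + 1) le_rfl).1
  rw [Nat.sub_self, coeff_zero_eq_eval_zero] at h
  simp [quadratic, h65] at h

end Multiplier

/-! ### Independence of the first two blocks of the polynomial solution. -/

section Solution

open Polynomial

variable {K : Type*} [Field K]

theorem W.shift_mem (p : ℕ) [CharP K p] {u : ℕ → K} (hu : u ∈ W K) :
    (fun n => u (p + n)) ∈ W K := by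
  intro n
  have h := hu (p + n)
  simpa [add_assoc] using h

/-- Within a block, a sequence satisfying the recurrence is determined by its first four terms. -/
theorem Satisfies.eq_zero_of_le (p : ℕ) [Fact p.Prime] [CharP K p] (h2 : (2 : K) ≠ 0)
    {u : ℕ → K} (hu : Satisfies u) (h : ∀ i : Fin 4, u (i + 1) = 0) :
    ∀ n, 1 ≤ n → n ≤ p → u n = 0 := by
  intro n
  induction n using Nat.strong_induction_on with
  | _ n ih =>
    intro h1 hp
    match n, h1 with
    | 1, _ => exact h 0
    | 2, _ => exact h 1
    | 3, _ => exact h 2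
    | 4, _ => exact h 3
    | n + 5, _ =>
      have hr := hu n
      have hz : 2 * (n : K) * u n = 0 := by
        cases n with
        | zero => simp
        | succ n => rw [ih (n + 1) (by omega) (by omega) (by omega), mul_zero]
      rw [hz, ih (n + 1) (by omega) (by omega) (by omega),
        ih (n + 2) (by omega) (by omega) (by omega), ih (n + 3) (by omega) (by omega) (by omega),
        ih (n + 4) (by omega) (by omega) (by omega)] at hr
      have hn : (n : K) + 4 ≠ 0 := by
        intro h0
        have h0' : ((n + 4 : ℕ) : K) = 0 := by exact_mod_cast h0
        have := Nat.le_of_dvd (by omega) ((CharP.cast_eq_zero_iff K p _).1 h0')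
        omega
      have h4 : (4 : K) ≠ 0 := by
        rw [show (4 : K) = 2 * 2 by norm_num]; exact mul_ne_zero h2 h2
      simpa [hn, h4] using hr

/-- The hypotheses are the vanishing of the three coefficients of `remainder u`. -/
theorem proj_eq_smul (h2 : (2 : K) ≠ 0) (h3 : (3 : K) ≠ 0) {u : ℕ → K}
    (ha : 4 * u 2 - 8 * u 1 = 0) (hb : 8 * u 3 + u 1 = 0)
    (hc : 12 * u 4 + 8 * u 3 + 2 * u 2 + 3 * u 1 = 0) :
    proj K u = u 1 • ![1, 2, -1 / 8, -1 / 2] := by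
  have h4 : (4 : K) ≠ 0 := by
    rw [show (4 : K) = 2 * 2 by norm_num]; exact mul_ne_zero h2 h2
  have h8 : (8 : K) ≠ 0 := by
    rw [show (8 : K) = 4 * 2 by norm_num]; exact mul_ne_zero h4 h2
  have e2 : u 2 = u 1 * 2 := by
    apply mul_left_cancel₀ h4; linear_combination ha
  have e3 : u 3 = u 1 * (-1 / 8) := by
    field_simp; linear_combination hb
  have e4 : u 4 = u 1 * (-1 / 2) := by
    rw [e2] at hc
    field_simp
    apply mul_left_cancel₀ (mul_ne_zero h2 h3); linear_combination hc - hb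
  ext i
  fin_cases i
  · simp [proj]
  · exact e2
  · exact e3
  · exact e4

theorem coeff_zero_sol (m : ℕ) : (sol K m).coeff 0 = 0 := by
  rw [sol, mul_assoc, coeff_X_mul_zero]

theorem coeff_one_sol (m : ℕ) : (sol K m).coeff 1 = 4 ^ m := by
  rw [sol, mul_assoc, coeff_X_mul, coeff_zero_eq_eval_zero]
  simp [quartic]

theorem natDegree_quartic : (quartic K).natDegree = 4 := by
  rw [quartic]
  compute_degree!

theorem monic_quartic : (quartic K).Monic := by
  rw [quartic]
  monicity!

theorem natDegree_sol (h2 : (2 : K) ≠ 0) (m : ℕ) : (sol K m).natDegree = 4 * m + 2 := by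
  have h : (X * (1 + 2 * X) : K[X]).natDegree = 2 := by
    compute_degree!
  have h0 : (X * (1 + 2 * X) : K[X]) ≠ 0 := by
    intro h0; rw [h0, natDegree_zero] at h; omega
  rw [sol, mul_comm, (monic_quartic.pow m).natDegree_mul' h0, monic_quartic.natDegree_pow,
    natDegree_quartic, h, mul_comm]

theorem proj_sol {m : ℕ} (h2 : (2 : K) ≠ 0) (h3 : (3 : K) ≠ 0) (hm : (2 * m + 1 : K) = 0) :
    proj K (sol K m).coeff = (4 : K) ^ m • ![1, 2, -1 / 8, -1 / 2] := by
  have h := (isPolySolution_sol hm).diffOp_eq_zero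
  have ha := coeff_two_diffOp (sol K m : PowerSeries K)
  have hb := coeff_three_diffOp (sol K m : PowerSeries K)
  have hc := coeff_four_diffOp (sol K m : PowerSeries K)
  simp only [h, map_zero, coeff_coe, coeff_zero_sol, sub_zero] at ha hb hc
  rw [← coeff_one_sol]
  exact proj_eq_smul h2 h3 ha.symm hb.symm hc.symm

/-- The polynomial `x (1 + 2x) (4 + (x + x²)²)` has no multiple root. -/
theorem not_sq_dvd (h2 : (2 : K) ≠ 0) (h65 : (65 : K) ≠ 0) {t : K} (ht : t ≠ 0) :
    ¬ (1 + C t * X) ^ 2 ∣ X * (1 + 2 * X) * quartic K := by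
  rintro ⟨r, hr⟩
  have h4 : (4 : K) ≠ 0 := by
    rw [show (4 : K) = 2 * 2 by norm_num]; exact mul_ne_zero h2 h2
  -- At this nonzero x both the product and its derivative vanish. Either x = −1/2 is also a root of
  -- S, or x is a double root of S; each is excluded by 16·S(−1/2) = 65 and S(0) = S(−1) = 4.
  obtain ⟨x, hx⟩ : ∃ x, 1 + t * x = 0 := ⟨-t⁻¹, by field_simp; ring⟩
  have h0 := congrArg (eval x) hr
  have h1 := congrArg (fun f => eval x (derivative f)) hr
  simp only [derivative_mul, derivative_X, derivative_add, derivative_one, derivative_ofNat,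
    derivative_quartic, derivative_C, pow_two (1 + C t * X)] at h1
  simp only [eval_mul, eval_add, eval_pow, eval_X, eval_C, eval_one, eval_ofNat, eval_zero, hx,
    quartic] at h0 h1
  rcases mul_eq_zero.1 (h0.trans (by ring : _ = (0 : K))) with h | h
  · rcases mul_eq_zero.1 h with h | h
    · rw [h] at hx
      simp at hx
    · apply h65
      have h2x : 2 * x = -1 := by linear_combination h
      have hS : (4 + (x + x ^ 2) ^ 2) * 16 = (65 : K) := by
        linear_combination (8 * x ^ 3 + 12 * x ^ 2 + 2 * x - 1) * h2x
      have hS0 : (4 + (x + x ^ 2) ^ 2) = (0 : K) := by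
        linear_combination -h1 + (2 * (4 + (x + x ^ 2) ^ 2)
          + x * (2 * (x + x ^ 2) * (1 + 2 * x))) * h
      rw [← hS, hS0, zero_mul]
  · have h5 : x * (1 + 2 * x) * (2 * (x + x ^ 2) * (1 + 2 * x)) = 0 := by
      linear_combination h1 - (1 + 4 * x) * h
    have h6 : (x + x ^ 2) * (1 + 2 * x) = 0 := by
      by_contra hne
      rw [show x * (1 + 2 * x) * (2 * (x + x ^ 2) * (1 + 2 * x))
        = (x * (1 + 2 * x)) * (2 * ((x + x ^ 2) * (1 + 2 * x))) by ring] at h5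
      rcases mul_eq_zero.1 h5 with h7 | h7
      · exact hne (by linear_combination (1 + x) * h7)
      · exact hne ((mul_eq_zero.1 h7).resolve_left h2)
    rcases mul_eq_zero.1 h6 with h7 | h7
    · rw [h7] at h
      exact h4 (by linear_combination h)
    · apply h65
      linear_combination 16 * h - (8 * x ^ 3 + 12 * x ^ 2 + 2 * x - 1) * h7

theorem sol_ne_mul {p : ℕ} [Fact p.Prime] {k : ℕ} (hp : p = 2 * k + 3) (h65 : (65 : ZMod p) ≠ 0)
    (t : ZMod p) : ¬ ∀ n, 1 ≤ n → n ≤ p →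
      (sol (ZMod p) (k + 1)).coeff (p + n) = t * (sol (ZMod p) (k + 1)).coeff n := by
  intro h
  have h2 : (2 : ZMod p) ≠ 0 := by
    intro h0
    have h0' : ((2 : ℕ) : ZMod p) = 0 := by exact_mod_cast h0
    have := Nat.le_of_dvd (by omega) ((ZMod.natCast_eq_zero_iff 2 p).1 h0')
    omega
  have hdeg : (sol (ZMod p) (k + 1)).natDegree = p + p := by
    rw [natDegree_sol h2]; omega
  have hne : sol (ZMod p) (k + 1) ≠ 0 := by
    intro h0; rw [h0, natDegree_zero] at hdeg; omega
  -- The degree is exactly 2p, so the last coefficient of the second block is nonzero.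
  have ht : t ≠ 0 := by
    rintro rfl
    have := h p (by omega) le_rfl
    rw [zero_mul, ← hdeg, coeff_natDegree, leadingCoeff_eq_zero] at this
    exact hne this
  set B : (ZMod p)[X] := ∑ i ∈ Finset.Icc 1 p, monomial i ((sol (ZMod p) (k + 1)).coeff i) with hB
  have cB (n : ℕ) : B.coeff n = if 1 ≤ n ∧ n ≤ p then (sol (ZMod p) (k + 1)).coeff n else 0 := by
    simp [hB, finsetSum_coeff, coeff_monomial]
  have hq : sol (ZMod p) (k + 1) = B + C t * (B * X ^ p) := by
    ext n
    rw [coeff_add, coeff_C_mul, coeff_mul_X_pow', cB, cB]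
    rcases Nat.eq_zero_or_pos n with rfl | hn
    · simp [coeff_zero_sol]
    by_cases h1 : n ≤ p
    · simp [h1, Nat.sub_eq_zero_of_le h1, Nat.one_le_iff_ne_zero.2 hn.ne']
    · obtain ⟨j, rfl⟩ := Nat.exists_eq_add_of_le (not_le.1 h1).le
      by_cases h3 : j ≤ p
      · simp [h1, h3, h j (by omega) h3, show 1 ≤ j by omega]
      · simp [h1, h3, coeff_eq_zero_of_natDegree_lt (show (sol (ZMod p) (k + 1)).natDegree
          < p + j by omega)]
  -- Frobenius together with t^p = t in the prime field.
  have hpow : (1 + C t * X) ^ p = 1 + C t * X ^ p := by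
    rw [add_pow_char, one_pow, mul_pow, ← C_pow, ZMod.pow_card]
  -- As p = 2(k+1) + 1, one factor is dropped on the left and x(1+2x) is raised on the right, so
  -- that (k+1)-th powers can be cancelled.
  have hdvd : ((1 + C t * X) ^ 2) ^ (k + 1)
      ∣ (X * (1 + 2 * X) * quartic (ZMod p)) ^ (k + 1) := by
    have d1 : ((1 + C t * X : (ZMod p)[X]) ^ 2) ^ (k + 1) ∣ (1 + C t * X) ^ p := by
      rw [← pow_mul]; exact pow_dvd_pow _ (by omega)
    have d2 : (1 + C t * X) ^ p ∣ sol (ZMod p) (k + 1) := by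
      rw [hpow, hq]; exact ⟨B, by ring⟩
    have d3 : sol (ZMod p) (k + 1) ∣ (X * (1 + 2 * X) * quartic (ZMod p)) ^ (k + 1) := by
      rw [sol, mul_pow]
      exact mul_dvd_mul (dvd_pow_self _ (Nat.succ_ne_zero k)) dvd_rfl
    exact d1.trans (d2.trans d3)
  exact not_sq_dvd h2 h65 ht
    ((UniqueFactorizationMonoid.pow_dvd_pow_iff_dvd (Nat.succ_ne_zero k)).1 hdvd)

/-- The block of coefficients of the polynomial solution following the first one is not
proportional to the first one. -/
theorem proj_shift_sol_ne {p : ℕ} [Fact p.Prime] {k : ℕ} (hp : p = 2 * k + 3)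
    (h3 : (3 : ZMod p) ≠ 0) (h65 : (65 : ZMod p) ≠ 0) (s : ZMod p) :
    proj (ZMod p) (fun n => (sol (ZMod p) (k + 1)).coeff (p + n))
      ≠ s • ![1, 2, -1 / 8, -1 / 2] := by
  intro h
  have h2 : (2 : ZMod p) ≠ 0 := by
    intro h0
    have h0' : ((2 : ℕ) : ZMod p) = 0 := by exact_mod_cast h0
    have := Nat.le_of_dvd (by omega) ((ZMod.natCast_eq_zero_iff 2 p).1 h0')
    omega
  have h4 : (4 : ZMod p) ^ (k + 1) ≠ 0 := by
    rw [show (4 : ZMod p) = 2 * 2 by norm_num]; exact pow_ne_zero _ (mul_ne_zero h2 h2)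
  have hm : (2 * ((k + 1 : ℕ) : ZMod p) + 1) = 0 := by
    have : ((2 * k + 3 : ℕ) : ZMod p) = 0 := by rw [← hp, CharP.cast_eq_zero]
    push_cast at this ⊢
    linear_combination this
  have hW := (isPolySolution_sol hm).coeff_mem_W
  refine sol_ne_mul hp h65 (s / 4 ^ (k + 1)) fun n h1 hn => ?_
  have he := (W (ZMod p)).sub_mem (W.shift_mem p hW) ((W (ZMod p)).smul_mem (s / 4 ^ (k + 1)) hW)
  have h0 : proj (ZMod p) ((fun n => (sol (ZMod p) (k + 1)).coeff (p + n))
      - (s / 4 ^ (k + 1)) • (sol (ZMod p) (k + 1)).coeff) = 0 := by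
    rw [map_sub, map_smul, h, proj_sol h2 h3 hm, smul_smul, div_mul_cancel₀ _ h4, sub_self]
  have := Satisfies.eq_zero_of_le p h2 he (fun i => by
    have := congrFun h0 i
    fin_cases i <;> exact this) n h1 hn
  simpa [sub_eq_zero] using this

end Solution

/-! ### Two independent vectors of V span it. -/

section Span

open Polynomial

variable {K : Type*} [Field K]

theorem W.hyperplane (p : ℕ) [CharP K p] {k : ℕ} (hp : p = 2 * k + 3)
    (h2 : (2 : K) ≠ 0) (h65 : (65 : K) ≠ 0) {u : ℕ → K} (hu : u ∈ W K) :
    6 * u 4 + u 2 + u 1 = 0 := by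
  have h4 : (4 : K) ≠ 0 := by
    rw [show (4 : K) = 2 * 2 by norm_num]; exact mul_ne_zero h2 h2
  obtain ⟨h, -⟩ := W.quadratic_relations p hp hu
    (γ := (12 * u 4 + 8 * u 3 + 2 * u 2 + 3 * u 1) / 4)
    (β := (8 * u 3 + u 1 - (12 * u 4 + 8 * u 3 + 2 * u 2 + 3 * u 1)) / 2)
    (by field_simp) (by field_simp) rfl
  have h0 : (quadratic K ^ (k + 1)).coeff 0 ≠ 0 := by
    rw [coeff_zero_eq_eval_zero]
    simp [quadratic, h65]
  have h := (mul_eq_zero.1 h).resolve_right h0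
  field_simp at h
  apply mul_left_cancel₀ h2
  linear_combination -h

theorem V_eq_span (p : ℕ) [Fact p.Prime] [CharP K p] {k : ℕ} (hp : p = 2 * k + 3)
    (h2 : (2 : K) ≠ 0) (h3 : (3 : K) ≠ 0) (h65 : (65 : K) ≠ 0)
    (hw : ![1, 2, -1 / 8, -1 / 2] ∈ V K) {v : Fin 4 → K} (hv : v ∈ V K)
    (hne : ∀ s : K, v ≠ s • ![1, 2, -1 / 8, -1 / 2]) :
    V K = Submodule.span K {![1, 2, -1 / 8, -1 / 2], v} := by
  have h4 : (4 : K) ≠ 0 := by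
    rw [show (4 : K) = 2 * 2 by norm_num]; exact mul_ne_zero h2 h2
  apply le_antisymm
  · rintro _ ⟨u, hu, rfl⟩
    obtain ⟨u', hu', rfl⟩ := hv
    have key {x : ℕ → K} (hx : x ∈ W K) :
        (4 * x 2 - 8 * x 1 - 2 * x 3 - x 1 / 4) * (quadratic K ^ (k + 1)).coeff (k + 2)
          + (2 * x 3 + x 1 / 4) * (quadratic K ^ (k + 1)).coeff (k + 1) = 0 := by
      have hh := W.hyperplane p hp h2 h65 hx
      refine (W.quadratic_relations p hp hx (β := 0) ?_ ?_ ?_).2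
      · field_simp; linear_combination -2 * hh
      · field_simp; ring
      · ring
    -- Since β = 0 already, α = γ = 0 kills the whole remainder.
    have of_zero {x : ℕ → K} (hx : x ∈ W K) (ha : 4 * x 2 - 8 * x 1 - 2 * x 3 - x 1 / 4 = 0)
        (hb : 2 * x 3 + x 1 / 4 = 0) : proj K x = x 1 • ![1, 2, -1 / 8, -1 / 2] := by
      have hh := W.hyperplane p hp h2 h65 hx
      have hb' : 8 * x 3 + x 1 = 0 := by field_simp at hb; linear_combination hb
      exact proj_eq_smul h2 h3 (by linear_combination ha + hb) hb'
        (by linear_combination 2 * hh + hb')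
    have hl : ∃ l : K, 4 * u 2 - 8 * u 1 - 2 * u 3 - u 1 / 4
        = l * (4 * u' 2 - 8 * u' 1 - 2 * u' 3 - u' 1 / 4)
        ∧ 2 * u 3 + u 1 / 4 = l * (2 * u' 3 + u' 1 / 4) := by
      have k1 := key hu
      have k2 := key hu'
      have hn : 4 * u' 2 - 8 * u' 1 - 2 * u' 3 - u' 1 / 4 = 0 → 2 * u' 3 + u' 1 / 4 ≠ 0 :=
        fun a b => hne _ (of_zero hu' a b)
      have hAB := coeff_quadratic_pow_ne_zero (K := K) p hp h65
      generalize (quadratic K ^ (k + 1)).coeff (k + 2) = A at *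
      generalize (quadratic K ^ (k + 1)).coeff (k + 1) = B at *
      generalize 4 * u 2 - 8 * u 1 - 2 * u 3 - u 1 / 4 = α at *
      generalize 2 * u 3 + u 1 / 4 = γ at *
      generalize 4 * u' 2 - 8 * u' 1 - 2 * u' 3 - u' 1 / 4 = α' at *
      generalize 2 * u' 3 + u' 1 / 4 = γ' at *
      -- Both pairs are annihilated by the same nonzero vector (A, B), hence are proportional.
      have hdet : α * γ' = α' * γ := by
        by_cases hB : B = 0
        · apply mul_right_cancel₀ (hAB hB); linear_combination γ' * k1 - γ * k2
        · apply mul_right_cancel₀ hB; linear_combination α * k2 - α' * k1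
      by_cases ha : α' = 0
      · have hg := hn ha
        refine ⟨γ / γ', ?_, by field_simp⟩
        field_simp
        linear_combination hdet
      · refine ⟨α / α', by field_simp, ?_⟩
        field_simp
        linear_combination -hdet
    obtain ⟨l, e1, e2⟩ := hl
    have hd := of_zero ((W K).sub_mem hu ((W K).smul_mem l hu'))
      (by simp only [Pi.sub_apply, Pi.smul_apply, smul_eq_mul]; linear_combination e1)
      (by simp only [Pi.sub_apply, Pi.smul_apply, smul_eq_mul]; linear_combination e2)
    rw [map_sub, map_smul, sub_eq_iff_eq_add] at hd
    exact Submodule.mem_span_pair.2 ⟨_, _, hd.symm⟩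
  · rw [Submodule.span_le]
    rintro x (rfl | rfl)
    · exact hw
    · exact hv

end Span

/-! ### Reduction of the rational sequence modulo p. -/

section Reduction

/-- The rational number `r` is `p`-integral and has residue `x` modulo `p`. -/
def HasResidue (p : ℕ) [Fact p.Prime] (r : ℚ) (x : ZMod p) : Prop :=
  ∃ a b : ℤ, (b : ZMod p) ≠ 0 ∧ r = a / b ∧ x = a / b

variable {p : ℕ} [Fact p.Prime]

theorem intCast_rat_ne_zero {b : ℤ} (hb : (b : ZMod p) ≠ 0) : (b : ℚ) ≠ 0 := by
  intro h
  rw [Int.cast_eq_zero] at h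
  simp [h] at hb

theorem HasResidue.intCast (a : ℤ) : HasResidue p a a := ⟨a, 1, by simp, by simp, by simp⟩

theorem HasResidue.add {r s : ℚ} {x y : ZMod p} (hr : HasResidue p r x) (hs : HasResidue p s y) :
    HasResidue p (r + s) (x + y) := by
  obtain ⟨a, b, hb, rfl, rfl⟩ := hr
  obtain ⟨c, d, hd, rfl, rfl⟩ := hs
  have hb' := intCast_rat_ne_zero hb
  have hd' := intCast_rat_ne_zero hd
  refine ⟨a * d + b * c, b * d, ?_, ?_, ?_⟩ <;> push_cast
  · exact mul_ne_zero hb hd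
  · field_simp
  · field_simp

theorem HasResidue.mul {r s : ℚ} {x y : ZMod p} (hr : HasResidue p r x) (hs : HasResidue p s y) :
    HasResidue p (r * s) (x * y) := by
  obtain ⟨a, b, hb, rfl, rfl⟩ := hr
  obtain ⟨c, d, hd, rfl, rfl⟩ := hs
  refine ⟨a * c, b * d, ?_, ?_, ?_⟩ <;> push_cast
  · exact mul_ne_zero hb hd
  · rw [div_mul_div_comm]
  · rw [div_mul_div_comm]

theorem HasResidue.div {r s : ℚ} {x y : ZMod p} (hr : HasResidue p r x) (hs : HasResidue p s y)
    (hy : y ≠ 0) : HasResidue p (r / s) (x / y) := by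
  obtain ⟨a, b, hb, rfl, rfl⟩ := hr
  obtain ⟨c, d, hd, rfl, rfl⟩ := hs
  have hc : (c : ZMod p) ≠ 0 := fun h => hy (by rw [h, zero_div])
  refine ⟨a * d, b * c, ?_, ?_, ?_⟩ <;> push_cast
  · exact mul_ne_zero hb hc
  · rw [div_div_div_eq]
  · rw [div_div_div_eq]

theorem HasResidue.neg {r : ℚ} {x : ZMod p} (hr : HasResidue p r x) :
    HasResidue p (-r) (-x) := by
  obtain ⟨a, b, hb, rfl, rfl⟩ := hr
  exact ⟨-a, b, hb, by push_cast; ring, by push_cast; ring⟩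

theorem HasResidue.exists_div {r : ℚ} (hr : HasResidue p r 0) : ∃ x, HasResidue p (r / p) x := by
  obtain ⟨a, b, hb, rfl, h⟩ := hr
  have ha : (a : ZMod p) = 0 := (div_eq_zero_iff.1 h.symm).resolve_right hb
  obtain ⟨a', rfl⟩ := (ZMod.intCast_zmod_eq_zero_iff_dvd a p).1 ha
  have hp : (p : ℚ) ≠ 0 := Nat.cast_ne_zero.2 (Fact.out : p.Prime).ne_zero
  have hb' := intCast_rat_ne_zero hb
  exact ⟨_, a', b, hb, by push_cast; field_simp, rfl⟩

theorem HasResidue.not_dvd_den {r : ℚ} {x : ZMod p} (hr : HasResidue p r x) : ¬ p ∣ r.den := by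
  obtain ⟨a, b, hb, rfl, -⟩ := hr
  intro h
  apply hb
  rw [ZMod.intCast_zmod_eq_zero_iff_dvd]
  refine (Int.natCast_dvd_natCast.2 h).trans ?_
  rw [← Rat.divInt_eq_div]
  exact Rat.den_dvd a b

theorem HasResidue.cast_eq {r : ℚ} {x : ZMod p} (hr : HasResidue p r x) : (r : ZMod p) = x := by
  obtain ⟨a, b, hb, rfl, rfl⟩ := hr
  rw [Rat.cast_div_of_ne_zero (by simp) (by simpa using hb), Rat.cast_intCast,
    Rat.cast_intCast]

/-- The numerator of the recursion formula for `c (n + 5)`. -/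
theorem HasResidue.numerator {y : ℕ → ZMod p} {n : ℕ}
    (h : ∀ i < 5, HasResidue p (c (n + i)) (y (n + i))) :
    HasResidue p (-(8 * ((n : ℚ) + 2) * c (n + 4) + ((n : ℚ) + 3) * c (n + 3)
      + (4 * (n : ℚ) + 7) * c (n + 2) + (5 * (n : ℚ) + 4) * c (n + 1)
      + 2 * (n : ℚ) * c n))
      (-(8 * ((n : ZMod p) + 2) * y (n + 4) + ((n : ZMod p) + 3) * y (n + 3)
      + (4 * (n : ZMod p) + 7) * y (n + 2) + (5 * (n : ZMod p) + 4) * y (n + 1)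
      + 2 * (n : ZMod p) * y n)) := by
  have key (a : ℤ) (i : ℕ) (hi : i < 5) : HasResidue p (a * c (n + i)) (a * y (n + i)) :=
    (HasResidue.intCast a).mul (h i hi)
  have := ((((key (8 * (n + 2)) 4 (by norm_num)).add (key (n + 3) 3 (by norm_num))).add
    (key (4 * n + 7) 2 (by norm_num))).add (key (5 * n + 4) 1 (by norm_num))).add
    (key (2 * n) 0 (by norm_num))
  push_cast at this
  exact this.neg

theorem c_add_five (n : ℕ) : c (n + 5) = -(8 * ((n : ℚ) + 2) * c (n + 4) + ((n : ℚ) + 3) * c (n + 3)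
      + (4 * (n : ℚ) + 7) * c (n + 2) + (5 * (n : ℚ) + 4) * c (n + 1)
      + 2 * (n : ℚ) * c n) / (4 * ((n : ℚ) + 4)) := by
  rw [c]

theorem HasResidue.c_add_five (h2 : (2 : ZMod p) ≠ 0) {y : ℕ → ZMod p} (hy : Satisfies y) {n : ℕ}
    (hn : (n : ZMod p) + 4 ≠ 0) (h : ∀ i < 5, HasResidue p (c (n + i)) (y (n + i))) :
    HasResidue p (c (n + 5)) (y (n + 5)) := by
  have h4 : (4 : ZMod p) ≠ 0 := by
    rw [show (4 : ZMod p) = 2 * 2 by norm_num]; exact mul_ne_zero h2 h2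
  have hd := HasResidue.intCast (p := p) (4 * (n + 4))
  push_cast at hd
  have := (HasResidue.numerator h).div hd (mul_ne_zero h4 hn)
  rw [ModPRecurrence.c_add_five]
  convert this using 1
  rw [eq_div_iff (mul_ne_zero h4 hn)]
  linear_combination hy n

theorem HasResidue.c_of_le (h2 : (2 : ZMod p) ≠ 0) {y : ℕ → ZMod p} (hy : Satisfies y)
    (h0 : y 0 = 0) (h : proj (ZMod p) y = ![1, 2, -1 / 8, -1 / 2]) :
    ∀ n ≤ p, HasResidue p (c n) (y n) := by
  have h8 : (8 : ZMod p) ≠ 0 := by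
    rw [show (8 : ZMod p) = 2 ^ 3 by norm_num]; exact pow_ne_zero _ h2
  intro n
  induction n using Nat.strong_induction_on with
  | _ n ih =>
    intro hp
    match n with
    | 0 => exact ⟨0, 1, by simp, by simp [c], by simp [h0]⟩
    | 1 => exact ⟨1, 1, by simp, by simp [c], by
      simpa using show y 1 = 1 from congrFun h 0⟩
    | 2 => exact ⟨2, 1, by simp, by simp [c], by
      simpa using show y 2 = 2 from congrFun h 1⟩
    | 3 => exact ⟨-1, 8, by simpa using h8, by simp [c], by
      simpa using show y 3 = -1 / 8 from congrFun h 2⟩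
    | 4 => exact ⟨-1, 2, by simpa using h2, by simp [c], by
      simpa using show y 4 = -1 / 2 from congrFun h 3⟩
    | n + 5 =>
      refine HasResidue.c_add_five h2 hy (fun h0 => ?_) fun i hi => ih _ (by omega) (by omega)
      have h0' : ((n + 4 : ℕ) : ZMod p) = 0 := by exact_mod_cast h0
      have := Nat.le_of_dvd (by omega) ((ZMod.natCast_eq_zero_iff _ p).1 h0')
      omega

/-- The first coefficient with denominator divisible by `p` in the recursion formula is still
`p`-integral. -/
theorem HasResidue.exists_c_succ (h2 : (2 : ZMod p) ≠ 0) (hp : 4 ≤ p) {y : ℕ → ZMod p}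
    (hy : Satisfies y) (h : ∀ n ≤ p, HasResidue p (c n) (y n)) :
    ∃ x, HasResidue p (c (p + 1)) x := by
  obtain ⟨n, hn⟩ := Nat.exists_eq_add_of_le' hp
  have h4 : (4 : ZMod p) ≠ 0 := by
    rw [show (4 : ZMod p) = 2 * 2 by norm_num]; exact mul_ne_zero h2 h2
  have hn0 : (n : ZMod p) + 4 = 0 := by
    have : ((n + 4 : ℕ) : ZMod p) = 0 := by rw [← hn, CharP.cast_eq_zero]
    exact_mod_cast this
  have hN := HasResidue.numerator (p := p) (y := y) (n := n) fun i hi => h _ (by omega)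
  have hz := hy n
  -- At n = p − 4 the leading coefficient vanishes modulo p, so the recurrence for y says that the
  -- numerator has residue 0, which absorbs the factor p of the denominator.
  rw [hn0, mul_zero, zero_mul, zero_add] at hz
  rw [hz, neg_zero] at hN
  obtain ⟨x, hx⟩ := hN.exists_div
  have hd := HasResidue.intCast (p := p) 4
  push_cast at hd
  have e : c (p + 1) = c (n + 5) := by rw [hn]
  have e2 : (p : ℚ) = n + 4 := by rw [hn]; push_cast; rfl
  have := hx.div hd h4
  rw [div_div, mul_comm _ (4 : ℚ), e2, ← ModPRecurrence.c_add_five, ← e] at this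
  exact ⟨_, this⟩

end Reduction


/-! ### Matching the second block with the reduction of c. -/

section Main

variable {p : ℕ} [Fact p.Prime]

/-- A sequence in `W` whose second block is the reduction of `c (p + 1), c (p + 2), …`. -/
theorem exists_lift_c {k : ℕ} (hp : p = 2 * k + 3) (h2 : (2 : ZMod p) ≠ 0)
    (h3 : (3 : ZMod p) ≠ 0) (h65 : (65 : ZMod p) ≠ 0) :
    ∃ y ∈ W (ZMod p), proj (ZMod p) y = ![1, 2, -1 / 8, -1 / 2] ∧
      (∀ s : ZMod p, proj (ZMod p) (fun n => y (p + n)) ≠ s • ![1, 2, -1 / 8, -1 / 2]) ∧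
      ∀ n ≤ p + 4, HasResidue p (c n) (y n) := by
  have hk : 1 ≤ k := by
    by_contra hk
    apply h3
    have : ((2 * k + 3 : ℕ) : ZMod p) = 0 := by rw [← hp, CharP.cast_eq_zero]
    simpa [show k = 0 by omega] using this
  have h4 : (4 : ZMod p) ^ (k + 1) ≠ 0 := by
    rw [show (4 : ZMod p) = 2 * 2 by norm_num]; exact pow_ne_zero _ (mul_ne_zero h2 h2)
  have hm : (2 * ((k + 1 : ℕ) : ZMod p) + 1) = 0 := by
    have : ((2 * k + 3 : ℕ) : ZMod p) = 0 := by rw [← hp, CharP.cast_eq_zero]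
    push_cast at this ⊢
    linear_combination this
  set q : ℕ → ZMod p := ((4 : ZMod p) ^ (k + 1))⁻¹ • (sol (ZMod p) (k + 1)).coeff with hq
  have hqW : q ∈ W (ZMod p) := (W _).smul_mem _ (isPolySolution_sol hm).coeff_mem_W
  have hqproj : proj (ZMod p) q = ![1, 2, -1 / 8, -1 / 2] := by
    rw [hq, map_smul, proj_sol h2 h3 hm, smul_smul, inv_mul_cancel₀ h4, one_smul]
  have hq0 : q 0 = 0 := by simp [hq, coeff_zero_sol]
  have hq1 : q 1 = 1 := congrFun hqproj 0
  have hres := HasResidue.c_of_le h2 hqW hq0 hqproj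
  obtain ⟨x, hx⟩ := HasResidue.exists_c_succ h2 (by omega) hqW hres
  have hsW : (fun n => if p ≤ n then q (n - p) else 0) ∈ W (ZMod p) := by
    have := (W _).smul_mem ((4 : ZMod p) ^ (k + 1))⁻¹
      ((isPolySolution_sol hm).expand_mul p Polynomial.X).coeff_mem_W
    convert this using 1
    ext n
    simp [Polynomial.coeff_X_pow_mul', hq]
  -- Because q₁ = 1, this multiple of x^p·q makes y_(p+1) = x and leaves the first block alone. The
  -- second block changes by a multiple of the first, so independence survives.
  set y : ℕ → ZMod p := q + (x - q (p + 1)) • fun n => if p ≤ n then q (n - p) else 0 with hy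
  have hyW : y ∈ W (ZMod p) := (W _).add_mem hqW ((W _).smul_mem _ hsW)
  have hyle : ∀ n ≤ p, y n = q n := by
    intro n hn
    rcases hn.lt_or_eq with h | rfl
    · simp [hy, not_le.2 h]
    · simp [hy, hq0]
  have hyadd : ∀ n, y (p + n) = q (p + n) + (x - q (p + 1)) * q n := by
    intro n
    simp [hy]
  refine ⟨y, hyW, ?_, ?_, ?_⟩
  · rw [← hqproj]
    ext i
    fin_cases i <;> exact hyle _ (by omega)
  · intro s hs
    apply proj_shift_sol_ne hp h3 h65 (4 ^ (k + 1) * (s - (x - q (p + 1))))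
    have e : (fun n => (sol (ZMod p) (k + 1)).coeff (p + n))
        = (4 : ZMod p) ^ (k + 1) • ((fun n => y (p + n)) - (x - q (p + 1)) • q) := by
      ext n
      simp only [Pi.smul_apply, Pi.sub_apply, hyadd, smul_eq_mul]
      simp [hq, h4]
    rw [e, map_smul, map_sub, map_smul, hs, hqproj, ← sub_smul, smul_smul]
  · have hle : ∀ n ≤ p + 1, HasResidue p (c n) (y n) := by
      intro n hn
      rcases Nat.le_or_eq_of_le_succ hn with h | rfl
      · rw [hyle n h]; exact hres n h
      · rw [Nat.succ_eq_add_one, hyadd, hq1]; convert hx using 1; ring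
    -- Beyond p + 1 the divisor for index p + i + 1 is 4(p+i) ≡ 4i, invertible for i = 1, 2, 3.
    have step (i : ℕ) (hi : i < 4) (h : ∀ n ≤ p + i, 1 ≤ i → HasResidue p (c n) (y n)) :
        ∀ n ≤ p + (i + 1), HasResidue p (c n) (y n) := by
      intro n hn
      by_cases hn1 : n ≤ p + 1
      · exact hle n hn1
      by_cases hn2 : n ≤ p + i
      · exact h n hn2 (by omega)
      obtain ⟨j, rfl⟩ : ∃ j, n = j + 5 := ⟨n - 5, by omega⟩
      refine HasResidue.c_add_five h2 hyW (fun h0 => ?_) fun l hl => h _ (by omega) (by omega)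
      have h0' : ((i : ℕ) : ZMod p) = 0 := by
        have : ((p + i : ℕ) : ZMod p) = 0 := by
          rw [show p + i = j + 4 by omega]; exact_mod_cast h0
        simpa using this
      have := Nat.le_of_dvd (by omega) ((ZMod.natCast_eq_zero_iff i p).1 h0')
      omega
    exact step 3 (by omega) fun n hn _ => step 2 (by omega) (fun n hn _ =>
      step 1 (by omega) (fun n hn _ => hle n hn) n hn) n hn

end Main

end ModPRecurrence

open ModPRecurrence in
/-- In the last part, `((c m : ℚ) : ZMod p)` is numerator over denominator in `ZMod p`; it is the
reduction of `c m` modulo `p` because `p` does not divide the denominator of `c m`. -/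
theorem theorem4 (p : ℕ) [Fact p.Prime] :
    ¬ Module.Finite (ZMod p) (ModPRecurrence.W (ZMod p)) ∧
    (p ≠ 2 → p ≠ 3 → p ≠ 5 → p ≠ 13 →
      Module.finrank (ZMod p) (ModPRecurrence.V (ZMod p)) = 2 ∧
      (∀ v ∈ ModPRecurrence.V (ZMod p), 6 * v 3 + v 1 + v 0 = 0) ∧
      (∀ i : Fin 4, ¬ p ∣ (ModPRecurrence.c (p + 1 + (i : ℕ))).den) ∧
      ModPRecurrence.V (ZMod p) = Submodule.span (ZMod p)
        {![1, 2, -1 / 8, -1 / 2],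
         ![((ModPRecurrence.c (p + 1) : ℚ) : ZMod p), ((ModPRecurrence.c (p + 2) : ℚ) : ZMod p),
           ((ModPRecurrence.c (p + 3) : ℚ) : ZMod p), ((ModPRecurrence.c (p + 4) : ℚ) : ZMod p)]}) := by
  have hprime : p.Prime := Fact.out
  constructor
  · rcases hprime.eq_two_or_odd' with rfl | ⟨m, hm⟩
    · refine not_finite_W_of_isPolySolution 2
        (isPolySolution_of_two (CharP.cast_eq_zero (ZMod 2) 2)) fun h => ?_
      have := congrArg (fun r => Polynomial.coeff r 2) h
      simp [Polynomial.coeff_X_pow] at this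
    · have hm' : (2 * (m : ZMod p) + 1) = 0 := by
        have : ((2 * m + 1 : ℕ) : ZMod p) = 0 := by rw [← hm, CharP.cast_eq_zero]
        exact_mod_cast this
      have h2 : (2 : ZMod p) ≠ 0 := by
        intro h0
        apply one_ne_zero (α := ZMod p)
        linear_combination hm' - (m : ZMod p) * h0
      refine not_finite_W_of_isPolySolution p (isPolySolution_sol hm') fun h => ?_
      have := natDegree_sol h2 m
      rw [h, Polynomial.natDegree_zero] at this
      omega
  · intro p2 p3 p5 p13
    have cast_ne {l : ℕ} (hl : l.Prime) (h : p ≠ l) : (l : ZMod p) ≠ 0 := fun h0 =>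
      h ((Nat.prime_dvd_prime_iff_eq hprime hl).1 ((ZMod.natCast_eq_zero_iff l p).1 h0))
    have h2 : (2 : ZMod p) ≠ 0 := cast_ne Nat.prime_two p2
    have h3 : (3 : ZMod p) ≠ 0 := cast_ne Nat.prime_three p3
    have h65 : (65 : ZMod p) ≠ 0 := by
      have := mul_ne_zero (cast_ne Nat.prime_five p5) (cast_ne (l := 13) (by norm_num) p13)
      norm_num at this
      exact this
    obtain ⟨m, hm⟩ := hprime.odd_of_ne_two p2
    obtain ⟨k, rfl⟩ : ∃ k, m = k + 1 := ⟨m - 1, by have := hprime.two_le; omega⟩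
    have hp : p = 2 * k + 3 := by omega
    obtain ⟨y, hyW, hy1, hyne, hyres⟩ := exists_lift_c hp h2 h3 h65
    have hw : ![1, 2, -1 / 8, -1 / 2] ∈ V (ZMod p) := ⟨y, hyW, hy1⟩
    have hv : proj (ZMod p) (fun n => y (p + n)) ∈ V (ZMod p) := ⟨_, W.shift_mem p hyW, rfl⟩
    have hspan := V_eq_span p hp h2 h3 h65 hw hv hyne
    have hc : proj (ZMod p) (fun n => y (p + n)) = ![((c (p + 1) : ℚ) : ZMod p),
        ((c (p + 2) : ℚ) : ZMod p), ((c (p + 3) : ℚ) : ZMod p), ((c (p + 4) : ℚ) : ZMod p)] := by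
      rw [(hyres (p + 1) (by omega)).cast_eq, (hyres (p + 2) (by omega)).cast_eq,
        (hyres (p + 3) (by omega)).cast_eq, (hyres (p + 4) (by omega)).cast_eq]
      rfl
    refine ⟨?_, ?_, fun i => (hyres _ (by omega)).not_dvd_den, ?_⟩
    · have hli : LinearIndependent (ZMod p)
          ![![1, 2, -1 / 8, -1 / 2], proj (ZMod p) (fun n => y (p + n))] := by
        rw [LinearIndependent.pair_iff' fun h => one_ne_zero (congrFun h 0)]
        exact fun a h => hyne a h.symm
      have := finrank_span_eq_card hli
      rw [Matrix.range_cons_cons_empty, ← hspan] at this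
      simpa using this
    · rintro _ ⟨u, hu, rfl⟩
      exact W.hyperplane p hp h2 h65 hu
    · rw [hspan, hc]
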